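/- Let $n\ge 3$ and $s\in(0,2)$, put $2^\star(s)=\frac{2(n-s)}{n-2}$ and $\mathbb{R}^n_-=\{x\in\mathbb{R}^n : x_1<0\}$, and let $\Delta=-\sum_{i=1}^n\partial_{ii}$ (Laplacian with the minus sign convention). Let $\mathcal{Q}$ be a linear subspace of $\mathbb{R}^n$ with $\dim\mathcal{Q}\ge 2$ and $\mathcal{Q}^\perp\subset\partial\mathbb{R}^n_-$, and let $\pi$ be the orthogonal projection onto $\mathcal{Q}$. Let $u\in C^2(\mathbb{R}^n_-)\cap C^1(\overline{\mathbb{R}^n_-})$ satisfy $$\Delta u=\frac{u^{2^\star(s)-1}}{|\pi(x)|^s}\ \text{ in }\mathbb{R}^n_-,\qquad u>0\ \text{ in }\mathbb{R}^n_-,\qquad u=0\ \text{ on }\partial\mathbb{R}^n_-,$$ and assume that for some $C>0$ one has $u(x)\le C(1+|x|)^{1-n}$ for all $x\in\mathbb{R}^n_-$. Then there exists $v\in C^2\big((-\infty,0)\times\mathbb{R}\times\mathcal{Q}^\perp\big)\cap C^1\big((-\infty,0]\times\mathbb{R}\times\mathcal{Q}^\perp\big)$ such that, for all $z\in\mathcal{Q}^\perp$,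 all $x_1<0$ and all $y\in\mathbb{R}^n$ with $y\perp e_1$ and $x_1e_1+y\in\mathcal{Q}$, where $e_1$ denotes the first vector of the canonical basis of $\mathbb{R}^n$, $$u(x_1e_1+y+z)=v(x_1,|y|,z).$$ -/

import Mathlib

noncomputable section

/-- The open half-space of points of `ℝⁿ` whose first coordinate is negative. -/
def negHalfSpace (n : ℕ) [NeZero n] : Set (EuclideanSpace ℝ (Fin n)) :=
  {x | x 0 < 0}

/-- The first vector of the canonical basis of `ℝⁿ`. -/
def firstVec (n : ℕ) [NeZero n] : EuclideanSpace ℝ (Fin n) :=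
  EuclideanSpace.single 0 1

/-- The critical exponent `2(n - s)/(n - 2)`. -/
def hardySobolevExponent (n : ℕ) (s : ℝ) : ℝ :=
  2 * ((n : ℝ) - s) / ((n : ℝ) - 2)

end

/-! The condition on `Qᗮ` puts `firstVec n` in `Q`. It is enough that `u` is invariant under
reflection across `ν`'s orthogonal hyperplane for every unit `ν ∈ Q` orthogonal to `firstVec n`:
such reflections carry any `y` to any vector of equal norm in the same slice.

This invariance comes from moving planes in the directions `ν` and `-ν`. For `l > 0` the reflection
decreases `‖Q.starProjection x‖` on the far side, so the weight increases and the difference of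
reflected and original `u` is a supersolution of a linear equation with potential `p * u ^ (p - 1) *
k`. No Kelvin transform is used: the decay of `u` makes the potential small against the inverse
square of the shifted distance to the boundary (`exists_potential_bound`). Hence the explicit
`planeBarrier` confines any failure of the comparison to a compact set away from both boundaries
(`exists_compact_reduction`). That set is empty for large `l`. As `l` decreases, the comparison is
strict on it (`lt_reflection`) and so survives small moves of the plane, down to every `l > 0`
(`le_reflection`) and to `0` in the limit. Opposite directions give equality (`reflection_zero_eq`).
-/

open Filter Topology RealInnerProductSpace InnerProductSpace Laplacian

/-! ### Laplacian through second derivatives along lines. -/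

section LaplacianLemmas

variable {E : Type*} [NormedAddCommGroup E] [InnerProductSpace ℝ E]

lemma ContDiffAt.eventually_hasDerivAt_line {f : E → ℝ} {x : E} (hf : ContDiffAt ℝ 2 f x) (v : E) :
    ∀ᶠ t : ℝ in 𝓝 0,
      HasDerivAt (fun t : ℝ => f (x + t • v)) (fderiv ℝ f (x + t • v) v) t := by
  have hd : ∀ᶠ y in 𝓝 x, DifferentiableAt ℝ f y :=
    (hf.eventually (by simp)).mono fun y hy => hy.differentiableAt (by simp)
  have ht : Tendsto (fun t : ℝ => x + t • v) (𝓝 0) (𝓝 x) := by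
    have : Continuous fun t : ℝ => x + t • v := by fun_prop
    simpa using this.tendsto 0
  filter_upwards [ht.eventually hd] with t h
  have hl : HasDerivAt (fun t : ℝ => x + t • v) v t := by
    simpa using ((hasDerivAt_id t).smul_const v).const_add x
  exact h.hasFDerivAt.comp_hasDerivAt t hl

/-- The second directional derivative as an iterated derivative along a line. -/
lemma ContDiffAt.iteratedFDeriv_two_eq_deriv_line {f : E → ℝ} {x : E} (hf : ContDiffAt ℝ 2 f x)
    (v : E) :
    iteratedFDeriv ℝ 2 f x ![v, v] = deriv (deriv fun t : ℝ => f (x + t • v)) 0 := by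
  have h1 : deriv (fun t : ℝ => f (x + t • v)) =ᶠ[𝓝 0] fun t => fderiv ℝ f (x + t • v) v :=
    (hf.eventually_hasDerivAt_line v).mono fun t ht => ht.deriv
  have h2 : DifferentiableAt ℝ (fderiv ℝ f) x :=
    (hf.fderiv_right (m := 1) (by norm_num)).differentiableAt (by simp)
  have hl : HasDerivAt (fun t : ℝ => x + t • v) v 0 := by
    simpa using ((hasDerivAt_id (0 : ℝ)).smul_const v).const_add x
  have h2' : HasFDerivAt (fderiv ℝ f) (fderiv ℝ (fderiv ℝ f) x) (x + (0 : ℝ) • v) := by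
    simpa using h2.hasFDerivAt
  have h3 : HasDerivAt (fun t : ℝ => fderiv ℝ f (x + t • v)) (fderiv ℝ (fderiv ℝ f) x v) 0 :=
    h2'.comp_hasDerivAt (0 : ℝ) hl
  have h4 : HasDerivAt (fun t : ℝ => fderiv ℝ f (x + t • v) v) (fderiv ℝ (fderiv ℝ f) x v v) 0 :=
    (ContinuousLinearMap.apply ℝ ℝ v).hasFDerivAt.comp_hasDerivAt (0 : ℝ) h3
  rw [h1.deriv_eq, iteratedFDeriv_two_apply, h4.deriv]
  rfl

/-- A negative second derivative would make `t` a local maximum too, so `g` would be constant near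
`t`. -/
lemma deriv_deriv_nonneg_of_isLocalMin {g : ℝ → ℝ} {t : ℝ} (h : IsLocalMin g t)
    (hc : ContinuousAt g t) : 0 ≤ deriv (deriv g) t := by
  by_contra! hneg
  have hmax := isLocalMax_of_deriv_deriv_neg hneg h.deriv_eq_zero hc
  have hconst : g =ᶠ[𝓝 t] fun _ => g t := by
    filter_upwards [h, hmax] with y h1 h2 using le_antisymm h2 h1
  have h0 : deriv (deriv g) t = 0 := by
    rw [hconst.deriv.deriv_eq]
    simp
  exact hneg.ne h0

variable [FiniteDimensional ℝ E]

lemma ContDiffAt.laplacian_eq_sum_deriv_line {ι : Type*} [Fintype ι] {f : E → ℝ} {x : E}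
    (hf : ContDiffAt ℝ 2 f x) (b : OrthonormalBasis ι ℝ E) :
    Δ f x = ∑ i, deriv (deriv fun t : ℝ => f (x + t • b i)) 0 := by
  rw [laplacian_eq_iteratedFDeriv_orthonormalBasis f b]
  exact Finset.sum_congr rfl fun i _ => hf.iteratedFDeriv_two_eq_deriv_line (b i)

lemma IsLocalMin.laplacian_nonneg {f : E → ℝ} {x : E} (h : IsLocalMin f x)
    (hf : ContDiffAt ℝ 2 f x) : 0 ≤ Δ f x := by
  rw [hf.laplacian_eq_sum_deriv_line (stdOrthonormalBasis ℝ E)]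
  refine Finset.sum_nonneg fun i _ => ?_
  set v := stdOrthonormalBasis ℝ E i
  have hl : Continuous fun t : ℝ => x + t • v := by fun_prop
  have ht : Tendsto (fun t : ℝ => x + t • v) (𝓝 0) (𝓝 x) := by simpa using hl.tendsto 0
  refine deriv_deriv_nonneg_of_isLocalMin ?_ ?_
  · filter_upwards [ht.eventually h] with t h1
    simpa using h1
  · exact (hf.eventually_hasDerivAt_line v).self_of_nhds.continuousAt

lemma laplacian_comp_linearIsometryEquiv_add (L : E ≃ₗᵢ[ℝ] E) (c : E) {f : E → ℝ} {x : E}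
    (hf : ContDiffAt ℝ 2 f (L x + c)) : Δ (fun y => f (L y + c)) x = Δ f (L x + c) := by
  have hg : ContDiffAt ℝ 2 (fun y => f (L y + c)) x :=
    ContDiffAt.comp x hf (L.contDiff.add contDiff_const).contDiffAt
  set b := stdOrthonormalBasis ℝ E
  rw [hg.laplacian_eq_sum_deriv_line b, hf.laplacian_eq_sum_deriv_line (b.map L)]
  refine Finset.sum_congr rfl fun i _ => ?_
  have : (fun t : ℝ => f (L (x + t • b i) + c)) = fun t : ℝ => f (L x + c + t • (b.map L) i) := by
    ext t
    congr 1
    simp only [map_add, map_smul, OrthonormalBasis.map_apply]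
    abel
  rw [this]

/-- The Laplacian of a plane wave with profile `g`. -/
lemma laplacian_comp_inner {a x : E} {g : ℝ → ℝ} (hg : ContDiffAt ℝ 2 g ⟪a, x⟫) :
    Δ (fun y => g ⟪a, y⟫) x = ‖a‖ ^ 2 * deriv (deriv g) ⟪a, x⟫ := by
  have hf : ContDiffAt ℝ 2 (fun y => g ⟪a, y⟫) x :=
    ContDiffAt.comp x hg (contDiff_const.inner ℝ contDiff_id).contDiffAt
  set b := stdOrthonormalBasis ℝ E
  rw [hf.laplacian_eq_sum_deriv_line b, ← b.sum_sq_norm_inner_left a, Finset.sum_mul]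
  refine Finset.sum_congr rfl fun i _ => ?_
  have h1 : (fun t : ℝ => g ⟪a, x + t • b i⟫) = fun t : ℝ => g (⟪a, b i⟫ * t + ⟪a, x⟫) := by
    ext t
    rw [inner_add_right, inner_smul_right]
    ring_nf
  have h2 : deriv (fun t : ℝ => g (⟪a, b i⟫ * t + ⟪a, x⟫)) =
      fun t => ⟪a, b i⟫ * deriv g (⟪a, b i⟫ * t + ⟪a, x⟫) := by
    ext t
    have := deriv_comp_mul_left ⟪a, b i⟫ (fun t => g (t + ⟪a, x⟫)) t
    simpa [deriv_comp_add_const] using this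
  rw [h1, h2, deriv_const_mul_field]
  have := deriv_comp_mul_left ⟪a, b i⟫ (fun t => deriv g (t + ⟪a, x⟫)) 0
  simp only [deriv_comp_add_const, smul_eq_mul, mul_zero, zero_add] at this
  rw [this, Real.norm_eq_abs, sq_abs]
  ring

end LaplacianLemmas

/-! ### Reflections across affine hyperplanes. -/

section Reflection

variable {E : Type*} [NormedAddCommGroup E] [InnerProductSpace ℝ E]

/-- The reflection of `x` across the hyperplane `{x | ⟪ν, x⟫ = l}`, for a unit vector `ν`. -/
noncomputable def planeReflection (ν : E) (l : ℝ) (x : E) : E :=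
  x + (2 * (l - ⟪ν, x⟫)) • ν

lemma inner_planeReflection_of_orthogonal {e ν : E} (h : ⟪e, ν⟫ = 0) (l : ℝ) (x : E) :
    ⟪e, planeReflection ν l x⟫ = ⟪e, x⟫ := by
  simp [planeReflection, inner_add_right, inner_smul_right, h]

lemma inner_planeReflection_self {ν : E} (h : ‖ν‖ = 1) (l : ℝ) (x : E) :
    ⟪ν, planeReflection ν l x⟫ = 2 * l - ⟪ν, x⟫ := by
  simp [planeReflection, inner_add_right, inner_smul_right, h]
  ring

lemma planeReflection_of_inner_eq {ν : E} {l : ℝ} {x : E} (h : ⟪ν, x⟫ = l) :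
    planeReflection ν l x = x := by
  simp [planeReflection, h]

lemma planeReflection_neg_zero (ν x : E) : planeReflection (-ν) 0 x = planeReflection ν 0 x := by
  simp [planeReflection]

lemma planeReflection_zero_involutive {ν : E} (h : ‖ν‖ = 1) (x : E) :
    planeReflection ν 0 (planeReflection ν 0 x) = x := by
  rw [planeReflection, inner_planeReflection_self h, planeReflection, add_assoc, ← add_smul]
  simp

/-- The hypothesis says that `x` and `x - d` have equal norm, so the hyperplane orthogonal to `d` is
their bisector. -/
lemma planeReflection_normalize {d x : E} (hd : d ≠ 0) (h : 2 * ⟪d, x⟫ = ‖d‖ ^ 2) :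
    planeReflection (‖d‖⁻¹ • d) 0 x = x - d := by
  have hd' : ‖d‖ ≠ 0 := norm_ne_zero_iff.2 hd
  have hc : 2 * (0 - ‖d‖⁻¹ * ⟪d, x⟫) * ‖d‖⁻¹ = -1 := by
    rw [show 2 * (0 - ‖d‖⁻¹ * ⟪d, x⟫) * ‖d‖⁻¹ = -(2 * ⟪d, x⟫) * (‖d‖⁻¹ * ‖d‖⁻¹) by ring, h]
    field_simp
  rw [planeReflection, real_inner_smul_left, smul_smul, hc, neg_one_smul, sub_eq_add_neg]

lemma planeReflection_eq_reflection_add {ν : E} (h : ‖ν‖ = 1) (l : ℝ) (x : E) :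
    planeReflection ν l x = (ℝ ∙ ν)ᗮ.reflection x + (2 * l) • ν := by
  rw [Submodule.reflection_orthogonal_apply, Submodule.reflection_singleton_apply, planeReflection]
  simp only [h, map_one, one_pow, div_one]
  module

lemma continuous_planeReflection (ν : E) : Continuous fun q : ℝ × E => planeReflection ν q.1 q.2 := by
  unfold planeReflection
  fun_prop

lemma laplacian_comp_planeReflection [FiniteDimensional ℝ E] {ν : E} (h : ‖ν‖ = 1) (l : ℝ)
    {f : E → ℝ} {x : E} (hf : ContDiffAt ℝ 2 f (planeReflection ν l x)) :
    Δ (fun y => f (planeReflection ν l y)) x = Δ f (planeReflection ν l x) := by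
  simp only [planeReflection_eq_reflection_add h] at hf ⊢
  exact laplacian_comp_linearIsometryEquiv_add _ _ hf

end Reflection

/-! ### Scalar inequalities and derivatives. -/

/-- Convexity: the power lies above its tangent at `b`. With `b` the value of `u` at the unreflected
point, the potential never involves the reflected value. -/
lemma rpow_sub_rpow_le {p a b : ℝ} (hp : 1 ≤ p) (ha : 0 ≤ a) (hb : 0 < b) :
    b ^ p - a ^ p ≤ p * b ^ (p - 1) * (b - a) := by
  have h := one_add_mul_self_le_rpow_one_add (s := a / b - 1) (p := p)
    (by have := div_nonneg ha hb.le; linarith) hp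
  rw [add_sub_cancel, Real.div_rpow ha hb.le, le_div_iff₀ (Real.rpow_pos_of_pos hb p)] at h
  have hb' : b ^ p = b ^ (p - 1) * b := by
    rw [← Real.rpow_add_one hb.ne']; ring_nf
  have : (1 + p * (a / b - 1)) * b ^ p = b ^ p - p * b ^ (p - 1) * (b - a) := by
    rw [hb']; field_simp; ring
  linarith

/-- The second derivative in `τ` of `√(1 - τ) + (1 - exp (A τ))`. -/
lemma deriv_deriv_sqrt_add_exp (A : ℝ) {τ : ℝ} (hτ : τ < 1) :
    deriv (deriv fun τ : ℝ => √(1 - τ) + (1 - Real.exp (A * τ))) τ =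
      -(1 / (4 * ((1 - τ) * √(1 - τ)))) - A ^ 2 * Real.exp (A * τ) := by
  have hlin : ∀ y : ℝ, HasDerivAt (fun τ : ℝ => 1 - τ) (-1) y := fun y => by
    simpa using (hasDerivAt_id y).const_sub 1
  have hexp : ∀ y : ℝ, HasDerivAt (fun τ : ℝ => Real.exp (A * τ)) (Real.exp (A * y) * A) y :=
    fun y => by simpa using ((hasDerivAt_id y).const_mul A).exp
  have hsq : ∀ y < (1 : ℝ), HasDerivAt (fun τ : ℝ => √(1 - τ)) (-1 / (2 * √(1 - y))) y :=
    fun y hy => (hlin y).sqrt (by linarith)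
  have h1 : deriv (fun τ : ℝ => √(1 - τ) + (1 - Real.exp (A * τ))) =ᶠ[𝓝 τ]
      fun y => -1 / (2 * √(1 - y)) + -(Real.exp (A * y) * A) := by
    filter_upwards [Iio_mem_nhds hτ] with y hy
    exact ((hsq y hy).add ((hexp y).const_sub 1)).deriv
  rw [h1.deriv_eq]
  have hpos : 0 < 1 - τ := by linarith
  have hs : 0 < √(1 - τ) := Real.sqrt_pos.2 hpos
  have h2 := ((hasDerivAt_const τ (-1 : ℝ)).div ((hsq τ hτ).const_mul 2) (by positivity)).add
    ((hexp τ).mul_const A).neg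
  refine h2.deriv.trans ?_
  have hss : √(1 - τ) ^ 2 = 1 - τ := Real.sq_sqrt hpos.le
  generalize √(1 - τ) = q at hs hss ⊢
  rw [← hss]
  field_simp
  ring

lemma deriv_deriv_one_sub_exp (A l τ : ℝ) :
    deriv (deriv fun τ : ℝ => 1 - Real.exp (-A * (τ - l))) τ =
      -(A ^ 2 * Real.exp (-A * (τ - l))) := by
  have hexp : ∀ y : ℝ,
      HasDerivAt (fun τ : ℝ => Real.exp (-A * (τ - l))) (Real.exp (-A * (y - l)) * -A) y :=
    fun y => by simpa using (((hasDerivAt_id y).sub_const l).const_mul (-A)).exp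
  have h1 : deriv (fun τ : ℝ => 1 - Real.exp (-A * (τ - l))) =
      fun y => -(Real.exp (-A * (y - l)) * -A) := by
    ext y
    exact ((hexp y).const_sub 1).deriv
  rw [h1]
  refine ((hexp τ).mul_const (-A)).neg.deriv.trans ?_
  ring

/-! ### The barrier. -/

section MovingPlanes

variable {E : Type*} [NormedAddCommGroup E] [InnerProductSpace ℝ E]

/-- The barrier of the moving plane argument: it is at least `1` where `⟪e, x⟫ ≤ 0` and
`l ≤ ⟪ν, x⟫`, and very concave in the strips of width `1 / A` along the boundary. -/
noncomputable def planeBarrier (e ν : E) (A l : ℝ) (x : E) : ℝ :=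
  (√(1 - ⟪e, x⟫) + (1 - Real.exp (A * ⟪e, x⟫))) + (1 - Real.exp (-A * (⟪ν, x⟫ - l)))

lemma one_le_planeBarrier {e ν x : E} {A l : ℝ} (hA : 0 ≤ A) (he : ⟪e, x⟫ ≤ 0)
    (hν : l ≤ ⟪ν, x⟫) : 1 ≤ planeBarrier e ν A l x := by
  have h1 : 1 ≤ √(1 - ⟪e, x⟫) := Real.one_le_sqrt.2 (by linarith)
  have h2 : Real.exp (A * ⟪e, x⟫) ≤ 1 := Real.exp_le_one_iff.2 (by nlinarith)
  have h3 : Real.exp (-A * (⟪ν, x⟫ - l)) ≤ 1 := Real.exp_le_one_iff.2 (by nlinarith)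
  unfold planeBarrier
  linarith

lemma planeBarrier_le {e ν x : E} {A l : ℝ} (he : ⟪e, x⟫ ≤ 0) :
    planeBarrier e ν A l x ≤ 3 * √(1 - ⟪e, x⟫) := by
  have h1 : 1 ≤ √(1 - ⟪e, x⟫) := Real.one_le_sqrt.2 (by linarith)
  have h2 := Real.exp_pos (A * ⟪e, x⟫)
  have h3 := Real.exp_pos (-A * (⟪ν, x⟫ - l))
  unfold planeBarrier
  linarith

lemma continuous_planeBarrier (e ν : E) (A l : ℝ) : Continuous (planeBarrier e ν A l) := by
  unfold planeBarrier
  fun_prop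

lemma contDiffAt_sqrt_add_exp (A : ℝ) {τ : ℝ} (hτ : τ < 1) :
    ContDiffAt ℝ 2 (fun τ : ℝ => √(1 - τ) + (1 - Real.exp (A * τ))) τ := by
  have h : ContDiffAt ℝ 2 (fun τ : ℝ => 1 - τ) τ := by fun_prop
  exact (h.sqrt (by linarith)).add (by fun_prop)

lemma contDiffAt_planeBarrier {e ν x : E} (A l : ℝ) (he : ⟪e, x⟫ < 0) :
    ContDiffAt ℝ 2 (planeBarrier e ν A l) x := by
  have h1 : ContDiffAt ℝ 2
      (fun y => √(1 - ⟪e, y⟫) + (1 - Real.exp (A * ⟪e, y⟫))) x :=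
    ContDiffAt.comp (g := fun τ : ℝ => √(1 - τ) + (1 - Real.exp (A * τ))) x
      (contDiffAt_sqrt_add_exp A (by linarith)) (contDiff_const.inner ℝ contDiff_id).contDiffAt
  have h2 : ContDiff ℝ 2 fun y => 1 - Real.exp (-A * (⟪ν, y⟫ - l)) :=
    ContDiff.comp (g := fun τ : ℝ => 1 - Real.exp (-A * (τ - l))) (by fun_prop)
      (contDiff_const.inner ℝ contDiff_id)
  exact h1.add h2.contDiffAt

lemma laplacian_planeBarrier [FiniteDimensional ℝ E] {e ν x : E} (h1 : ‖e‖ = 1) (h2 : ‖ν‖ = 1)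
    (A l : ℝ) (he : ⟪e, x⟫ < 0) :
    Δ (planeBarrier e ν A l) x =
      -(1 / (4 * ((1 - ⟪e, x⟫) * √(1 - ⟪e, x⟫)))) - A ^ 2 * Real.exp (A * ⟪e, x⟫)
        - A ^ 2 * Real.exp (-A * (⟪ν, x⟫ - l)) := by
  have hg1 := contDiffAt_sqrt_add_exp A (τ := ⟪e, x⟫) (by linarith)
  have hg2 : ContDiff ℝ 2 fun τ : ℝ => 1 - Real.exp (-A * (τ - l)) := by fun_prop
  have hf1 : ContDiffAt ℝ 2 (fun y => √(1 - ⟪e, y⟫) + (1 - Real.exp (A * ⟪e, y⟫))) x :=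
    ContDiffAt.comp (g := fun τ : ℝ => √(1 - τ) + (1 - Real.exp (A * τ))) x
      hg1 (contDiff_const.inner ℝ contDiff_id).contDiffAt
  have hf2 : ContDiff ℝ 2 fun y => 1 - Real.exp (-A * (⟪ν, y⟫ - l)) :=
    ContDiff.comp (g := fun τ : ℝ => 1 - Real.exp (-A * (τ - l))) (by fun_prop)
      (contDiff_const.inner ℝ contDiff_id)
  have hsum := hf1.laplacian_add hf2.contDiffAt
  have e1 := laplacian_comp_inner (a := e) (x := x) hg1
  have e2 := laplacian_comp_inner (a := ν) (x := x) hg2.contDiffAt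
  rw [deriv_deriv_sqrt_add_exp A (by linarith), h1] at e1
  rw [deriv_deriv_one_sub_exp, h2] at e2
  refine hsum.trans ?_
  rw [e1, e2]
  ring

end MovingPlanes

/-! ### The moving plane method. -/

section MovingPlaneMethod

variable {E : Type*} [NormedAddCommGroup E] [InnerProductSpace ℝ E] [FiniteDimensional ℝ E]

/-- A positive solution `u` of `-Δ u = u ^ p * k` on the half-space `{x | ⟪e, x⟫ < 0}`, vanishing
on its boundary and at infinity, to which the moving plane method in the direction `ν` applies. -/
structure IsMovingPlaneSolution (e ν : E) (p : ℝ) (k u : E → ℝ) : Prop where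
  norm_normal : ‖e‖ = 1
  norm_dir : ‖ν‖ = 1
  inner_eq_zero : ⟪e, ν⟫ = 0
  one_le : 1 ≤ p
  continuousOn : ContinuousOn u {x | ⟪e, x⟫ ≤ 0}
  contDiffAt : ∀ x, ⟪e, x⟫ < 0 → ContDiffAt ℝ 2 u x
  pos : ∀ x, ⟪e, x⟫ < 0 → 0 < u x
  boundary : ∀ x, ⟪e, x⟫ = 0 → u x = 0
  equation : ∀ x, ⟪e, x⟫ < 0 → -Δ u x = u x ^ p * k x
  decay : ∀ ε > 0, ∃ R, ∀ x, ⟪e, x⟫ < 0 → R ≤ ‖x‖ → u x ≤ ε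
  weight_pos : ∀ x, ⟪e, x⟫ < 0 → 0 < k x
  weight_lt : ∀ l > 0, ∀ x, ⟪e, x⟫ < 0 → l < ⟪ν, x⟫ → k x < k (planeReflection ν l x)
  potential_le : ∀ l > 0, ∃ M, ∀ x, ⟪e, x⟫ < 0 → l ≤ ⟪ν, x⟫ → p * u x ^ (p - 1) * k x ≤ M
  potential_decay : ∀ l > 0, ∀ ε > 0, ∃ R, ∀ x, ⟪e, x⟫ < 0 → l ≤ ⟪ν, x⟫ → R ≤ ‖x‖ →
    p * u x ^ (p - 1) * k x * (1 - ⟪e, x⟫) ^ 2 ≤ ε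

namespace IsMovingPlaneSolution

variable {e ν : E} {p : ℝ} {k u : E → ℝ}

lemma nonneg (h : IsMovingPlaneSolution e ν p k u) {x : E} (hx : ⟪e, x⟫ ≤ 0) : 0 ≤ u x := by
  rcases hx.lt_or_eq with hx | hx
  · exact (h.pos x hx).le
  · exact (h.boundary x hx).ge

lemma inner_reflection (h : IsMovingPlaneSolution e ν p k u) (l : ℝ) (x : E) :
    ⟪e, planeReflection ν l x⟫ = ⟪e, x⟫ :=
  inner_planeReflection_of_orthogonal h.inner_eq_zero l x

lemma contDiffAt_reflection (h : IsMovingPlaneSolution e ν p k u) (l : ℝ) {x : E}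
    (hx : ⟪e, x⟫ < 0) : ContDiffAt ℝ 2 (fun y => u (planeReflection ν l y)) x := by
  have hr : ContDiff ℝ 2 (planeReflection ν l) := by
    have : ContDiff ℝ 2 fun y : E => ⟪ν, y⟫ := contDiff_const.inner ℝ contDiff_id
    unfold planeReflection
    fun_prop
  exact ContDiffAt.comp x (h.contDiffAt _ (by rwa [h.inner_reflection])) hr.contDiffAt

lemma laplacian_difference (h : IsMovingPlaneSolution e ν p k u) (l : ℝ) {x : E}
    (hx : ⟪e, x⟫ < 0) :
    Δ (fun y => u (planeReflection ν l y) - u y) x =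
      u x ^ p * k x - u (planeReflection ν l x) ^ p * k (planeReflection ν l x) := by
  have hx' : ⟪e, planeReflection ν l x⟫ < 0 := by rwa [h.inner_reflection]
  have h1 : Δ (fun y => u (planeReflection ν l y) - u y) x = _ :=
    (h.contDiffAt_reflection l hx).laplacian_sub (h.contDiffAt x hx)
  have h2 := h.equation x hx
  have h3 := h.equation _ hx'
  rw [h1, laplacian_comp_planeReflection h.norm_dir l (h.contDiffAt _ hx')]
  linarith

/-- Replacing the reflected weight by the smaller `k x` only increases the right side; convexity
then linearizes the power. -/
lemma laplacian_difference_le (h : IsMovingPlaneSolution e ν p k u) {l : ℝ} (hl : 0 < l) {x : E}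
    (hx : ⟪e, x⟫ < 0) (hν : l < ⟪ν, x⟫) :
    Δ (fun y => u (planeReflection ν l y) - u y) x ≤
      p * u x ^ (p - 1) * k x * (u x - u (planeReflection ν l x)) := by
  have hx' : ⟪e, planeReflection ν l x⟫ < 0 := by rwa [h.inner_reflection]
  rw [h.laplacian_difference l hx]
  have h1 := rpow_sub_rpow_le h.one_le (h.pos _ hx').le (h.pos _ hx)
  have h2 := mul_le_mul_of_nonneg_right h1 (h.weight_pos x hx).le
  have h3 := mul_le_mul_of_nonneg_left (h.weight_lt l hl x hx hν).le
    (Real.rpow_nonneg (h.pos _ hx').le p)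
  nlinarith

/-- The comparison principle with a positive strict supersolution `φ` of the linearized equation,
required only where the difference is negative. -/
lemma difference_nonneg_of_barrier (h : IsMovingPlaneSolution e ν p k u) {l : ℝ} (hl : 0 < l)
    {φ : E → ℝ} (hφ : Continuous φ)
    (hφ2 : ∀ x, ⟪e, x⟫ < 0 → ContDiffAt ℝ 2 φ x)
    (hφ1 : ∀ x, ⟪e, x⟫ ≤ 0 → l ≤ ⟪ν, x⟫ → 1 ≤ φ x)
    (hsup : ∀ x, ⟪e, x⟫ < 0 → l < ⟪ν, x⟫ → u (planeReflection ν l x) < u x →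
      p * u x ^ (p - 1) * k x * φ x < -Δ φ x) {x : E} (hx : ⟪e, x⟫ ≤ 0) (hν : l ≤ ⟪ν, x⟫) :
    u x ≤ u (planeReflection ν l x) := by
  by_contra! hneg
  set w : E → ℝ := fun y => u (planeReflection ν l y) - u y with hw
  set D : Set E := {y | ⟪e, y⟫ ≤ 0 ∧ l ≤ ⟪ν, y⟫} with hD
  have hce : Continuous fun y : E => ⟪e, y⟫ := by fun_prop
  have hcν : Continuous fun y : E => ⟪ν, y⟫ := by fun_prop
  have hDc : IsClosed D :=
    (isClosed_le hce continuous_const).inter (isClosed_le continuous_const hcν)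
  have hrefl : Continuous (planeReflection ν l) :=
    (continuous_planeReflection ν).comp (Continuous.prodMk_right l)
  have hwc : ContinuousOn w D := by
    refine ContinuousOn.sub ?_ (h.continuousOn.mono fun y hy => hy.1)
    refine h.continuousOn.comp hrefl.continuousOn fun y hy => ?_
    change ⟪e, planeReflection ν l y⟫ ≤ 0
    rw [h.inner_reflection]
    exact hy.1
  have hφpos : ∀ y ∈ D, 0 < φ y := fun y hy => zero_lt_one.trans_le (hφ1 y hy.1 hy.2)
  have hqc : ContinuousOn (fun y => w y / φ y) D :=
    hwc.div hφ.continuousOn fun y hy => (hφpos y hy).ne'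
  have hxD : x ∈ D := ⟨hx, hν⟩
  have hwx : w x / φ x < 0 := div_neg_of_neg_of_pos (sub_neg.2 hneg) (hφpos x hxD)
  have hwe : ∀ y, ⟪e, y⟫ = 0 → w y = 0 := fun y hy => by
    simp only [hw]
    rw [h.boundary y hy, h.boundary _ ((h.inner_reflection l y).trans hy), sub_self]
  obtain ⟨R, hR⟩ := h.decay (-(w x / φ x)) (by linarith)
  -- Since `φ ≥ 1` and `u` tends to zero, the quotient cannot go below its value at `x` near
  -- infinity, so its minimum over the unbounded `D` is attained.
  have hinf : ∀ᶠ y in cocompact E ⊓ 𝓟 D, w x / φ x ≤ w y / φ y := by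
    have hfar : ∀ᶠ y in cocompact E, R ≤ ‖y‖ :=
      (tendsto_norm_cocompact_atTop (E := E)).eventually (eventually_ge_atTop R)
    filter_upwards [hfar.filter_mono inf_le_left, (eventually_principal.2 fun y hy => hy :
      ∀ᶠ y in 𝓟 D, y ∈ D).filter_mono inf_le_right] with y hyR hyD
    have h1 := hφ1 y hyD.1 hyD.2
    have h3 : w x / φ x ≤ w y := by
      rcases hyD.1.lt_or_eq with hy | hy
      · have h2 := h.nonneg (x := planeReflection ν l y) (by rw [h.inner_reflection]; exact hyD.1)
        have h3 := hR y hy hyR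
        simp only [hw] at h3 ⊢
        linarith
      · rw [hwe y hy]
        exact hwx.le
    rw [le_div_iff₀ (hφpos y hyD)]
    nlinarith
  obtain ⟨z, hzD, hz⟩ := hqc.exists_isMinOn' hDc hxD hinf
  have hzneg : w z / φ z < 0 := (hz hxD).trans_lt hwx
  have hwz : w z < 0 := by
    by_contra! hcon
    exact hzneg.not_ge (div_nonneg hcon (hφpos z hzD).le)
  have hze : ⟪e, z⟫ < 0 := hzD.1.lt_of_ne fun hy => hwz.ne (hwe z hy)
  have hzν : l < ⟪ν, z⟫ := by
    refine hzD.2.lt_of_ne fun hy => hwz.ne ?_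
    simp only [hw]
    rw [planeReflection_of_inner_eq hy.symm, sub_self]
  set m : ℝ := w z / φ z with hm
  have hmφ : w z = m * φ z := (div_mul_cancel₀ _ (hφpos z hzD).ne').symm
  -- The multiple `m • φ` touches `w` from below at `z`, so `Δ w z ≥ m * Δ φ z`; as `m < 0`, this
  -- contradicts strict supersolution.
  have hmin : IsLocalMin (fun y => w y - (m • φ) y) z := by
    have hnhds : ∀ᶠ y in 𝓝 z, y ∈ D := by
      filter_upwards [hce.continuousAt.eventually_lt_const hze,
        hcν.continuousAt.eventually_const_lt hzν] with y h1 h2 using ⟨h1.le, h2.le⟩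
    filter_upwards [hnhds] with y hy
    have h1 : m ≤ w y / φ y := hz hy
    rw [le_div_iff₀ (hφpos y hy)] at h1
    simp only [Pi.smul_apply, smul_eq_mul]
    linarith
  have hw2 : ContDiffAt ℝ 2 w z := (h.contDiffAt_reflection l hze).sub (h.contDiffAt z hze)
  have hφz := hφ2 z hze
  have hmφ2 : ContDiffAt ℝ 2 (m • φ) z := contDiffAt_const.smul hφz
  have hlap := hmin.laplacian_nonneg (hw2.sub hmφ2)
  have hsub : Δ (fun y => w y - (m • φ) y) z = Δ w z - Δ (m • φ) z := hw2.laplacian_sub hmφ2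
  rw [hsub, laplacian_smul m hφz, smul_eq_mul] at hlap
  have h1 : Δ w z ≤ _ := h.laplacian_difference_le hl hze hzν
  have h2 := hsup z hze hzν (sub_neg.1 hwz)
  have h3 : u z - u (planeReflection ν l z) = -(m * φ z) := by rw [← hmφ]; simp [hw]
  rw [h3] at h1
  nlinarith

/-- It suffices to compare `u` with its reflection on a compact set at positive distance from the
boundary, which can be chosen uniformly in `l ≥ l₀`. -/
lemma exists_compact_reduction (h : IsMovingPlaneSolution e ν p k u) {l₀ : ℝ} (hl₀ : 0 < l₀) :
    ∃ R A : ℝ, 0 < A ∧ ∀ l ≥ l₀,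
      (∀ x, ‖x‖ ≤ R → ⟪e, x⟫ ≤ -(1 / A) → l + 1 / A ≤ ⟪ν, x⟫ → u x ≤ u (planeReflection ν l x)) →
      ∀ x, ⟪e, x⟫ ≤ 0 → l ≤ ⟪ν, x⟫ → u x ≤ u (planeReflection ν l x) := by
  obtain ⟨M, hM⟩ := h.potential_le l₀ hl₀
  obtain ⟨R, hR⟩ := h.potential_decay l₀ hl₀ (1 / 24) (by norm_num)
  -- In the strips within the ball, the potential term is at most `B / 3 < A / 3 ≤ A ^ 2 / 3`, which
  -- the exponential term exceeds because `exp (-1) ≥ 1 / 3`.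
  set B : ℝ := 9 * (max M 0 * √(1 + max R 0)) with hB
  have hB0 : 0 ≤ B := by positivity
  have hA : 0 < 1 + B := by linarith
  refine ⟨R, 1 + B, hA, fun l hl hcomp x hx hν => ?_⟩
  set A : ℝ := 1 + B with hAdef
  refine h.difference_nonneg_of_barrier (hl₀.trans_le hl) (continuous_planeBarrier e ν A l)
    (fun y hy => contDiffAt_planeBarrier A l hy)
    (fun y hy hy' => one_le_planeBarrier hA.le hy hy') (fun y hy hyν hlt => ?_) hx hν
  rw [laplacian_planeBarrier h.norm_normal h.norm_dir A l hy]
  set c := p * u y ^ (p - 1) * k y with hc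
  have hc0 : 0 ≤ c := mul_nonneg (mul_nonneg (zero_le_one.trans h.one_le)
    (Real.rpow_nonneg (h.pos y hy).le _)) (h.weight_pos y hy).le
  have hφ := mul_le_mul_of_nonneg_left
    (planeBarrier_le (e := e) (ν := ν) (A := A) (l := l) hy.le) hc0
  set q := √(1 - ⟪e, y⟫) with hq
  have hq1 : 1 ≤ q := Real.one_le_sqrt.2 (by linarith)
  have hq2 : q ^ 2 = 1 - ⟪e, y⟫ := Real.sq_sqrt (by linarith)
  have hE1 : 0 < A ^ 2 * Real.exp (A * ⟪e, y⟫) := by positivity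
  have hE2 : 0 < A ^ 2 * Real.exp (-A * (⟪ν, y⟫ - l)) := by positivity
  have hT : 0 < 1 / (4 * ((1 - ⟪e, y⟫) * q)) := by rw [← hq2]; positivity
  by_cases hfar : R ≤ ‖y‖
  · have h1 := hR y hy (hl.trans hyν.le) hfar
    rw [← hc, ← hq2] at h1
    -- Far out the square root alone suffices: the bound `1 / 24` makes the potential term at most
    -- half of what its concavity supplies.
    have h2 : c * (3 * q) ≤ 1 / 2 * (1 / (4 * ((1 - ⟪e, y⟫) * q))) := by
      rw [← hq2, show (1 : ℝ) / 2 * (1 / (4 * (q ^ 2 * q))) = 1 / 8 / q ^ 3 by field_simp; norm_num,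
        le_div_iff₀ (by positivity)]
      linarith [show c * (3 * q) * q ^ 3 = 3 * (c * (q ^ 2) ^ 2) by ring]
    linarith
  · push Not at hfar
    have hstrip : ∀ t : ℝ, A * t ≤ 1 → c * (3 * q) < A ^ 2 * Real.exp (-(A * t)) := by
      intro t ht
      have he1 : 1 / 3 ≤ Real.exp (-(A * t)) := by
        refine le_trans ?_ (Real.exp_le_exp.2 (neg_le_neg ht))
        rw [Real.exp_neg, one_div]
        exact inv_anti₀ (Real.exp_pos 1) (by linarith [Real.exp_one_lt_d9])
      have hqR : q ≤ √(1 + max R 0) := by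
        refine Real.sqrt_le_sqrt ?_
        have h1 := abs_real_inner_le_norm e y
        rw [h.norm_normal, one_mul] at h1
        have := neg_le_of_abs_le h1
        have := le_max_left R 0
        linarith
      have hcM : c ≤ max M 0 := (hM y hy (hl.trans hyν.le)).trans (le_max_left _ _)
      have h1 : c * q ≤ max M 0 * √(1 + max R 0) :=
        mul_le_mul hcM hqR (by linarith) (le_max_right _ _)
      have h2 : A ≤ A ^ 2 := by nlinarith
      have h3 := mul_le_mul_of_nonneg_left he1 (sq_nonneg A)
      linarith
    by_cases hs1 : ⟪e, y⟫ ≤ -(1 / A)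
    · by_cases hs2 : l + 1 / A ≤ ⟪ν, y⟫
      · exact absurd hlt (hcomp y hfar.le hs1 hs2).not_gt
      · push Not at hs2
        have h1 := hstrip (⟪ν, y⟫ - l) (by
          have := mul_le_mul_of_nonneg_left (show ⟪ν, y⟫ - l ≤ 1 / A by linarith) hA.le
          rwa [mul_one_div_cancel hA.ne'] at this)
        rw [← neg_mul] at h1
        linarith
    · push Not at hs1
      have h1 := hstrip (-⟪e, y⟫) (by
        have := mul_le_mul_of_nonneg_left (show -⟪e, y⟫ ≤ 1 / A by linarith) hA.le
        rwa [mul_one_div_cancel hA.ne'] at this)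
      rw [mul_neg, neg_neg] at h1
      linarith

/-- No strong maximum principle is needed: at an interior contact point the difference has a local
minimum, yet its Laplacian is `u ^ p` times a strictly negative difference of weights. -/
lemma lt_reflection (h : IsMovingPlaneSolution e ν p k u) {l : ℝ} (hl : 0 < l)
    (hle : ∀ x, ⟪e, x⟫ ≤ 0 → l ≤ ⟪ν, x⟫ → u x ≤ u (planeReflection ν l x)) {x : E}
    (hx : ⟪e, x⟫ < 0) (hν : l < ⟪ν, x⟫) : u x < u (planeReflection ν l x) := by
  refine (hle x hx.le hν.le).lt_of_ne fun heq => ?_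
  have hmin : IsLocalMin (fun y => u (planeReflection ν l y) - u y) x := by
    have hce : Continuous fun y : E => ⟪e, y⟫ := by fun_prop
    have hcν : Continuous fun y : E => ⟪ν, y⟫ := by fun_prop
    filter_upwards [hce.continuousAt.eventually_lt_const hx,
      hcν.continuousAt.eventually_const_lt hν] with y h1 h2
    rw [← heq, sub_self]
    exact sub_nonneg.2 (hle y h1.le h2.le)
  have h1 := hmin.laplacian_nonneg ((h.contDiffAt_reflection l hx).sub (h.contDiffAt x hx))
  rw [h.laplacian_difference l hx, ← heq] at h1
  have h2 := mul_lt_mul_of_pos_left (h.weight_lt l hl x hx hν) (Real.rpow_pos_of_pos (h.pos x hx) p)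
  linarith

lemma le_reflection_of_forall_gt (h : IsMovingPlaneSolution e ν p k u) {l : ℝ}
    (hle : ∀ l' > l, ∀ x, ⟪e, x⟫ ≤ 0 → l' ≤ ⟪ν, x⟫ → u x ≤ u (planeReflection ν l' x)) {x : E}
    (hx : ⟪e, x⟫ ≤ 0) (hν : l ≤ ⟪ν, x⟫) : u x ≤ u (planeReflection ν l x) := by
  rcases hν.eq_or_lt with hν | hν
  · rw [planeReflection_of_inner_eq hν.symm]
  rcases hx.eq_or_lt with hx | hx
  · rw [h.boundary x hx, h.boundary _ ((h.inner_reflection l x).trans hx)]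
  have hr : Continuous fun l' : ℝ => planeReflection ν l' x :=
    (continuous_planeReflection ν).comp (Continuous.prodMk_left x)
  have hcont : ContinuousAt (fun l' : ℝ => u (planeReflection ν l' x)) l :=
    ContinuousAt.comp (f := fun l' : ℝ => planeReflection ν l' x)
      (h.contDiffAt (planeReflection ν l x) (by rwa [h.inner_reflection])).continuousAt
      hr.continuousAt
  refine ge_of_tendsto (hcont.tendsto.mono_left (nhdsWithin_le_nhds (s := Set.Ioi l))) ?_
  filter_upwards [Ioo_mem_nhdsGT hν] with l' hl'
  exact hle l' hl'.1 x hx.le hl'.2.le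

lemma eventually_le_reflection_on_compact (h : IsMovingPlaneSolution e ν p k u) {l : ℝ} {K : Set E}
    (hK : IsCompact K) (hKe : ∀ x ∈ K, ⟪e, x⟫ < 0) (hlt : ∀ x ∈ K, u x < u (planeReflection ν l x)) :
    ∀ᶠ l' in 𝓝 l, ∀ x ∈ K, u x ≤ u (planeReflection ν l' x) := by
  refine hK.eventually_forall_of_forall_eventually fun x hx => ?_
  have h1 : ContinuousAt (fun q : ℝ × E => u q.2) (l, x) :=
    ContinuousAt.comp (f := fun q : ℝ × E => q.2) (h.contDiffAt x (hKe x hx)).continuousAt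
      continuousAt_snd
  have h2 : ContinuousAt (fun q : ℝ × E => u (planeReflection ν q.1 q.2)) (l, x) :=
    ContinuousAt.comp (f := fun q : ℝ × E => planeReflection ν q.1 q.2)
      (h.contDiffAt (planeReflection ν l x)
        (by rw [h.inner_reflection]; exact hKe x hx)).continuousAt
      (continuous_planeReflection ν).continuousAt
  filter_upwards [h1.eventually_lt h2 (hlt x hx)] with q hq using hq.le

lemma le_reflection (h : IsMovingPlaneSolution e ν p k u) {l : ℝ} (hl : 0 < l) :
    ∀ x, ⟪e, x⟫ ≤ 0 → l ≤ ⟪ν, x⟫ → u x ≤ u (planeReflection ν l x) := by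
  obtain ⟨R, A, hA, hred⟩ := h.exists_compact_reduction hl
  set P : ℝ → Prop := fun m => ∀ x, ⟪e, x⟫ ≤ 0 → m ≤ ⟪ν, x⟫ → u x ≤ u (planeReflection ν m x)
  set S : Set ℝ := {m | l ≤ m ∧ ¬ P m}
  have hA' : 0 < 1 / A := by positivity
  -- For `m > R` the compact set left by the reduction is empty.
  have hbdd : ∀ m ∈ S, m ≤ R := by
    rintro m ⟨hm, hPm⟩
    by_contra! hRm
    refine hPm (hred m hm fun x hxR _ hxν => ?_)
    have h1 := real_inner_le_norm ν x
    rw [h.norm_dir, one_mul] at h1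
    linarith
  by_contra hPl
  have hlS : l ∈ S := ⟨le_rfl, hPl⟩
  have hlub := isLUB_csSup ⟨l, hlS⟩ ⟨R, hbdd⟩
  set m := sSup S
  have hlm : l ≤ m := hlub.1 hlS
  have hm0 : 0 < m := hl.trans_le hlm
  have hPm : P m := fun x hx hν => h.le_reflection_of_forall_gt (l := m) (fun m' hm' => by
    by_contra hPm'
    exact (hlub.1 (show m' ∈ S from ⟨hlm.trans hm'.le, hPm'⟩)).not_gt hm') hx hν
  -- Half the margin in `ν` is given up so that `K` contains the set to be checked for every `m'`
  -- slightly below `m`.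
  set K : Set E := {x | ‖x‖ ≤ R ∧ ⟪e, x⟫ ≤ -(1 / A) ∧ m + 1 / A / 2 ≤ ⟪ν, x⟫}
  have hK : IsCompact K := by
    refine (isCompact_closedBall (0 : E) R).of_isClosed_subset ?_ fun x hx => by simpa using hx.1
    have hce : Continuous fun y : E => ⟪e, y⟫ := by fun_prop
    have hcν : Continuous fun y : E => ⟪ν, y⟫ := by fun_prop
    exact (isClosed_le continuous_norm continuous_const).inter
      ((isClosed_le hce continuous_const).inter (isClosed_le continuous_const hcν))
  have hev := h.eventually_le_reflection_on_compact (l := m) hK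
    (fun x hx => by linarith [hx.2.1])
    (fun x hx => h.lt_reflection hm0 hPm (by linarith [hx.2.1]) (by linarith [hx.2.2]))
  have hev2 : ∀ᶠ m' in 𝓝 m, m - 1 / A / 2 < m' := lt_mem_nhds (by linarith)
  obtain ⟨m', ⟨hlm', hPm'⟩, hm'⟩ := ((hlub.frequently_mem ⟨l, hlS⟩).and_eventually
    (nhdsWithin_le_nhds (hev.and hev2))).exists
  refine hPm' (hred m' hlm' fun x hxR hxe hxν => hm'.1 x ⟨hxR, hxe, ?_⟩)
  linarith [hm'.2]

lemma le_reflection_zero (h : IsMovingPlaneSolution e ν p k u) {x : E} (hx : ⟪e, x⟫ ≤ 0)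
    (hν : 0 ≤ ⟪ν, x⟫) : u x ≤ u (planeReflection ν 0 x) :=
  h.le_reflection_of_forall_gt (fun _ hl => h.le_reflection hl) hx hν

/-- A solution to which the method applies in both directions `ν` and `-ν` is symmetric. -/
lemma reflection_zero_eq (h : IsMovingPlaneSolution e ν p k u)
    (h' : IsMovingPlaneSolution e (-ν) p k u) {x : E} (hx : ⟪e, x⟫ ≤ 0) :
    u (planeReflection ν 0 x) = u x := by
  have key : ∀ y, ⟪e, y⟫ ≤ 0 → u y ≤ u (planeReflection ν 0 y) := by
    intro y hy
    rcases le_total 0 ⟪ν, y⟫ with hν | hν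
    · exact h.le_reflection_zero hy hν
    · have := h'.le_reflection_zero hy (by rw [inner_neg_left]; linarith)
      rwa [planeReflection_neg_zero] at this
  refine le_antisymm ?_ (key x hx)
  have := key (planeReflection ν 0 x) (by rwa [h.inner_reflection])
  rwa [planeReflection_zero_involutive h.norm_dir] at this

end IsMovingPlaneSolution

end MovingPlaneMethod

/-! ### The half-space in terms of inner products. -/

section HalfSpace

variable {n : ℕ} [NeZero n]

lemma inner_firstVec (x : EuclideanSpace ℝ (Fin n)) : ⟪firstVec n, x⟫ = x 0 := by
  simp [firstVec, EuclideanSpace.inner_single_left]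

lemma norm_firstVec : ‖firstVec n‖ = 1 := by
  simp [firstVec]

lemma mem_negHalfSpace {x : EuclideanSpace ℝ (Fin n)} :
    x ∈ negHalfSpace n ↔ ⟪firstVec n, x⟫ < 0 := by
  rw [inner_firstVec]; rfl

lemma isOpen_negHalfSpace : IsOpen (negHalfSpace n) :=
  isOpen_lt (by fun_prop) continuous_const

lemma negHalfSpace_eq_preimage :
    negHalfSpace n = EuclideanSpace.proj (𝕜 := ℝ) (0 : Fin n) ⁻¹' Set.Iio 0 := rfl

lemma proj_zero_surjective :
    Function.Surjective (EuclideanSpace.proj (𝕜 := ℝ) (0 : Fin n) : EuclideanSpace ℝ (Fin n) → ℝ) :=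
  fun a => ⟨EuclideanSpace.single 0 a, by simp⟩

lemma mem_closure_negHalfSpace {x : EuclideanSpace ℝ (Fin n)} :
    x ∈ closure (negHalfSpace n) ↔ ⟪firstVec n, x⟫ ≤ 0 := by
  rw [negHalfSpace_eq_preimage, ContinuousLinearMap.closure_preimage _ proj_zero_surjective,
    closure_Iio, inner_firstVec]
  rfl

lemma mem_frontier_negHalfSpace {x : EuclideanSpace ℝ (Fin n)} :
    x ∈ frontier (negHalfSpace n) ↔ ⟪firstVec n, x⟫ = 0 := by
  rw [negHalfSpace_eq_preimage, ContinuousLinearMap.frontier_preimage _ proj_zero_surjective,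
    frontier_Iio, inner_firstVec]
  rfl

end HalfSpace

/-! ### Effect of reflections on the weight. -/

section Weight

variable {E : Type*} [NormedAddCommGroup E] [InnerProductSpace ℝ E]

lemma inner_starProjection_of_mem {Q : Submodule ℝ E} [Q.HasOrthogonalProjection] {a : E}
    (ha : a ∈ Q) (x : E) : ⟪a, Q.starProjection x⟫ = ⟪a, x⟫ := by
  rw [← Submodule.inner_starProjection_left_eq_right, Submodule.starProjection_eq_self_iff.2 ha]

lemma abs_inner_le_norm_starProjection {Q : Submodule ℝ E} [Q.HasOrthogonalProjection] {a : E}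
    (ha : a ∈ Q) (h : ‖a‖ = 1) (x : E) : |⟪a, x⟫| ≤ ‖Q.starProjection x‖ := by
  have := abs_real_inner_le_norm a (Q.starProjection x)
  rwa [inner_starProjection_of_mem ha, h, one_mul] at this

/-- The squared norm changes by `4 * l * (l - ⟪ν, x⟫)`, which is negative. -/
lemma norm_starProjection_planeReflection_lt {Q : Submodule ℝ E} [Q.HasOrthogonalProjection]
    {ν : E} (hν : ν ∈ Q) (h : ‖ν‖ = 1) {l : ℝ} (hl : 0 < l) {x : E} (hx : l < ⟪ν, x⟫) :
    ‖Q.starProjection (planeReflection ν l x)‖ < ‖Q.starProjection x‖ := by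
  refine lt_of_pow_lt_pow_left₀ 2 (norm_nonneg _) ?_
  rw [planeReflection, map_add, map_smul, Submodule.starProjection_eq_self_iff.2 hν,
    norm_add_sq_real, real_inner_smul_right, real_inner_comm ν (Q.starProjection x),
    inner_starProjection_of_mem hν, norm_smul, h, mul_one, Real.norm_eq_abs, sq_abs]
  nlinarith

/-- A subspace of dimension at least two contains a unit vector orthogonal to a given vector. -/
lemma exists_unit_mem_orthogonal [FiniteDimensional ℝ E] {Q : Submodule ℝ E}
    (hQ : 2 ≤ Module.finrank ℝ Q) {e : E} (he : e ∈ Q) (h : ‖e‖ = 1) :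
    ∃ ν ∈ Q, ‖ν‖ = 1 ∧ ⟪e, ν⟫ = 0 := by
  have hnot : ¬ Q ≤ ℝ ∙ e := fun hle => by
    have h1 := Submodule.finrank_mono hle
    have h2 := finrank_span_le_card (R := ℝ) ({e} : Set E)
    simp only [Set.toFinset_singleton, Finset.card_singleton] at h2
    omega
  obtain ⟨y, hyQ, hye⟩ := SetLike.not_le_iff_exists.1 hnot
  set d := y - ⟪e, y⟫ • e with hd
  have hdQ : d ∈ Q := Q.sub_mem hyQ (Q.smul_mem _ he)
  have hd0 : d ≠ 0 := fun h0 => hye (by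
    rw [sub_eq_zero.1 h0]
    exact Submodule.smul_mem _ _ (Submodule.mem_span_singleton_self e))
  refine ⟨‖d‖⁻¹ • d, Q.smul_mem _ hdQ, norm_smul_inv_norm hd0, ?_⟩
  rw [real_inner_smul_right, hd, inner_sub_right, real_inner_smul_right,
    real_inner_self_eq_norm_sq, h]
  simp

end Weight

/-! ### Decay of the potential. -/

/-- Decay of the linearized potential, for `T` the distance to a shifted boundary and `X` the
distance to a point. -/
lemma rpow_potential_le {s X T : ℝ} (hs : s < 2) (hT : 1 ≤ T) (hTX : T ≤ X) :
    X ^ (-(4 - 2 * s)) * (T ^ s)⁻¹ * T ^ 2 ≤ X ^ (-(2 - s)) := by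
  have hT0 : 0 < T := by linarith
  have hX0 : 0 < X := by linarith
  have h1 : (T ^ s)⁻¹ * T ^ 2 = T ^ (2 - s) := by
    rw [← Real.rpow_neg hT0.le, ← Real.rpow_natCast T 2, ← Real.rpow_add hT0]
    congr 1
    push_cast
    ring
  have h2 : T ^ (2 - s) ≤ X ^ (2 - s) := Real.rpow_le_rpow hT0.le hTX (by linarith)
  calc X ^ (-(4 - 2 * s)) * (T ^ s)⁻¹ * T ^ 2
      = X ^ (-(4 - 2 * s)) * T ^ (2 - s) := by rw [mul_assoc, h1]
    _ ≤ X ^ (-(4 - 2 * s)) * X ^ (2 - s) :=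
        mul_le_mul_of_nonneg_left h2 (Real.rpow_nonneg hX0.le _)
    _ = X ^ (-(2 - s)) := by
        rw [← Real.rpow_add hX0]
        congr 1
        ring

lemma hardySobolevExponent_sub_two {n : ℕ} (hn : 3 ≤ n) (s : ℝ) :
    hardySobolevExponent n s - 1 - 1 = (4 - 2 * s) / ((n : ℝ) - 2) := by
  have : (3 : ℝ) ≤ n := by exact_mod_cast hn
  have h2 : (n : ℝ) - 2 ≠ 0 := by linarith
  unfold hardySobolevExponent
  field_simp
  ring

/-- The potential of the linearized equation decays faster than the inverse square of the distance
to the boundary of the half-space. -/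
lemma exists_potential_bound {n : ℕ} [NeZero n] (hn : 3 ≤ n)
    {Q : Submodule ℝ (EuclideanSpace ℝ (Fin n))} (he : firstVec n ∈ Q)
    {s : ℝ} (hs0 : 0 < s) (hs2 : s < 2) {u : EuclideanSpace ℝ (Fin n) → ℝ}
    (hpos : ∀ x ∈ negHalfSpace n, 0 < u x) {C : ℝ} (hC : 0 < C)
    (hbound : ∀ x ∈ negHalfSpace n, u x ≤ C * (1 + ‖x‖) ^ (1 - (n : ℝ)))
    {ν : EuclideanSpace ℝ (Fin n)} (hνQ : ν ∈ Q) (hν : ‖ν‖ = 1) {l : ℝ} (hl : 0 < l) :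
    ∃ K, 0 < K ∧ ∀ x, ⟪firstVec n, x⟫ < 0 → l ≤ ⟪ν, x⟫ →
      (hardySobolevExponent n s - 1) * u x ^ (hardySobolevExponent n s - 1 - 1) *
        (‖Q.starProjection x‖ ^ s)⁻¹ * (1 - ⟪firstVec n, x⟫) ^ 2 ≤ K * (1 + ‖x‖) ^ (-(2 - s)) := by
  have hn3 : (3 : ℝ) ≤ n := by exact_mod_cast hn
  have hexp := hardySobolevExponent_sub_two hn s
  set p := hardySobolevExponent n s - 1
  have hp0 : 0 < p - 1 := by rw [hexp]; exact div_pos (by linarith) (by linarith)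
  -- The projection has norm at least `l` and at least `-⟪firstVec n, x⟫`; combining the two gives
  -- the lower bound `κ * T`.
  set κ := l / (1 + l) with hκ
  have hκ0 : 0 < κ := by positivity
  refine ⟨p * C ^ (p - 1) * (κ ^ s)⁻¹, mul_pos (mul_pos (by linarith) (Real.rpow_pos_of_pos hC _))
    (inv_pos.2 (Real.rpow_pos_of_pos hκ0 s)), fun x hx hxν => ?_⟩
  have hxH := mem_negHalfSpace.2 hx
  set T := 1 - ⟪firstVec n, x⟫ with hT
  have hT1 : 1 ≤ T := by linarith
  have hTX : T ≤ 1 + ‖x‖ := by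
    have h1 := abs_real_inner_le_norm (firstVec n) x
    rw [norm_firstVec, one_mul] at h1
    linarith [neg_le_of_abs_le h1]
  have hX1 : 1 ≤ 1 + ‖x‖ := by linarith [norm_nonneg x]
  have hu : u x ^ (p - 1) ≤ C ^ (p - 1) * (1 + ‖x‖) ^ (-(4 - 2 * s)) := by
    calc u x ^ (p - 1) ≤ (C * (1 + ‖x‖) ^ (1 - (n : ℝ))) ^ (p - 1) :=
          Real.rpow_le_rpow (hpos x hxH).le (hbound x hxH) hp0.le
      _ = C ^ (p - 1) * (1 + ‖x‖) ^ ((1 - (n : ℝ)) * (p - 1)) := by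
          rw [Real.mul_rpow hC.le (Real.rpow_nonneg (by linarith) _), ← Real.rpow_mul (by linarith)]
      _ ≤ C ^ (p - 1) * (1 + ‖x‖) ^ (-(4 - 2 * s)) := by
          refine mul_le_mul_of_nonneg_left (Real.rpow_le_rpow_of_exponent_le hX1 ?_)
            (Real.rpow_nonneg hC.le _)
          -- The decay exponent `n - 1` exceeds `n - 2`, so the extra `p - 1` can be dropped.
          have h1 : (p - 1) * ((n : ℝ) - 2) = 4 - 2 * s := by
            rw [hexp]
            exact div_mul_cancel₀ _ (by linarith)
          linarith
  have hπ : κ * T ≤ ‖Q.starProjection x‖ := by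
    have h1 := (le_abs_self _).trans (abs_inner_le_norm_starProjection hνQ hν x)
    have h2 := (neg_le_abs _).trans (abs_inner_le_norm_starProjection he norm_firstVec x)
    rw [hκ, div_mul_eq_mul_div, div_le_iff₀ (by positivity)]
    have h3 := mul_le_mul_of_nonneg_left h2 hl.le
    linarith
  have hk : (‖Q.starProjection x‖ ^ s)⁻¹ ≤ (κ ^ s)⁻¹ * (T ^ s)⁻¹ := by
    rw [← mul_inv, ← Real.mul_rpow hκ0.le (by linarith)]
    exact inv_anti₀ (Real.rpow_pos_of_pos (by positivity) s)
      (Real.rpow_le_rpow (by positivity) hπ hs0.le)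
  have hp1 : 0 ≤ p := by linarith
  have hX : 0 ≤ (1 + ‖x‖) ^ (-(4 - 2 * s)) := Real.rpow_nonneg (by linarith) _
  calc p * u x ^ (p - 1) * (‖Q.starProjection x‖ ^ s)⁻¹ * T ^ 2
      ≤ p * (C ^ (p - 1) * (1 + ‖x‖) ^ (-(4 - 2 * s))) * ((κ ^ s)⁻¹ * (T ^ s)⁻¹) * T ^ 2 := by
        gcongr
    _ = p * C ^ (p - 1) * (κ ^ s)⁻¹ * ((1 + ‖x‖) ^ (-(4 - 2 * s)) * (T ^ s)⁻¹ * T ^ 2) := by ring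
    _ ≤ p * C ^ (p - 1) * (κ ^ s)⁻¹ * (1 + ‖x‖) ^ (-(2 - s)) :=
        mul_le_mul_of_nonneg_left (rpow_potential_le hs2 hT1 hTX) (by positivity)

lemma exists_forall_rpow_neg_le {a K ε : ℝ} (ha : 0 < a) (hε : 0 < ε) :
    ∃ R, ∀ r ≥ R, K * (1 + r) ^ (-a) ≤ ε := by
  have h : Tendsto (fun r : ℝ => K * (1 + r) ^ (-a)) atTop (𝓝 (K * 0)) :=
    ((tendsto_rpow_neg_atTop ha).comp (tendsto_atTop_add_const_left _ 1 tendsto_id)).const_mul K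
  rw [mul_zero] at h
  exact eventually_atTop.1 (h.eventually (ge_mem_nhds hε))

lemma isMovingPlaneSolution_of_decay {n : ℕ} [NeZero n] (hn : 3 ≤ n)
    {Q : Submodule ℝ (EuclideanSpace ℝ (Fin n))} (he : firstVec n ∈ Q)
    {s : ℝ} (hs0 : 0 < s) (hs2 : s < 2) {u : EuclideanSpace ℝ (Fin n) → ℝ}
    (hu2 : ContDiffOn ℝ 2 u (negHalfSpace n))
    (hu0 : ContinuousOn u (closure (negHalfSpace n)))
    (heq : ∀ x ∈ negHalfSpace n,
      -(Laplacian.laplacian u x) =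
        u x ^ (hardySobolevExponent n s - 1) / ‖Q.starProjection x‖ ^ s)
    (hpos : ∀ x ∈ negHalfSpace n, 0 < u x)
    (hbdry : ∀ x ∈ frontier (negHalfSpace n), u x = 0) {C : ℝ} (hC : 0 < C)
    (hbound : ∀ x ∈ negHalfSpace n, u x ≤ C * (1 + ‖x‖) ^ (1 - (n : ℝ)))
    {ν : EuclideanSpace ℝ (Fin n)} (hνQ : ν ∈ Q) (hν : ‖ν‖ = 1) (hνe : ⟪firstVec n, ν⟫ = 0) :
    IsMovingPlaneSolution (firstVec n) ν (hardySobolevExponent n s - 1)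
      (fun x => (‖Q.starProjection x‖ ^ s)⁻¹) u := by
  have hn3 : (3 : ℝ) ≤ n := by exact_mod_cast hn
  have hp : 1 ≤ hardySobolevExponent n s - 1 := by
    have : 0 ≤ (4 - 2 * s) / ((n : ℝ) - 2) := div_nonneg (by linarith) (by linarith)
    linarith [hardySobolevExponent_sub_two hn s]
  have hπ : ∀ x, ⟪firstVec n, x⟫ < 0 → 0 < ‖Q.starProjection x‖ := fun x hx =>
    (abs_pos.2 hx.ne).trans_le (abs_inner_le_norm_starProjection he norm_firstVec x)
  have hpot : ∀ l > (0 : ℝ), _ := fun l hl =>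
    exists_potential_bound hn he hs0 hs2 hpos hC hbound hνQ hν (l := l) hl
  refine ⟨norm_firstVec, hν, hνe, hp, ?_, fun x hx => ?_, fun x hx => hpos x (mem_negHalfSpace.2 hx),
    fun x hx => hbdry x (mem_frontier_negHalfSpace.2 hx), fun x hx => ?_, fun ε hε => ?_,
    fun x hx => inv_pos.2 (Real.rpow_pos_of_pos (hπ x hx) s), fun l hl x hx hlx => ?_,
    fun l hl => ?_, fun l hl ε hε => ?_⟩
  · exact hu0.mono fun x hx => mem_closure_negHalfSpace.2 hx
  · exact hu2.contDiffAt (isOpen_negHalfSpace.mem_nhds (mem_negHalfSpace.2 hx))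
  · rw [heq x (mem_negHalfSpace.2 hx), div_eq_mul_inv]
  · obtain ⟨R, hR⟩ := exists_forall_rpow_neg_le (a := (n : ℝ) - 1) (K := C) (by linarith) hε
    refine ⟨R, fun x hx hxR => (hbound x (mem_negHalfSpace.2 hx)).trans ?_⟩
    simpa using hR _ hxR
  · have hx' : ⟪firstVec n, planeReflection ν l x⟫ < 0 := by
      rwa [inner_planeReflection_of_orthogonal hνe]
    exact inv_strictAnti₀ (Real.rpow_pos_of_pos (hπ _ hx') s)
      (Real.rpow_lt_rpow (norm_nonneg _) (norm_starProjection_planeReflection_lt hνQ hν hl hlx) hs0)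
  · obtain ⟨K, hK, h⟩ := hpot l hl
    refine ⟨K, fun x hx hlx => ?_⟩
    have h1 := h x hx hlx
    have h2 : (1 + ‖x‖) ^ (-(2 - s)) ≤ 1 :=
      Real.rpow_le_one_of_one_le_of_nonpos (by linarith [norm_nonneg x]) (by linarith)
    have h3 := mul_le_mul_of_nonneg_left h2 hK.le
    have h4 : 0 ≤ (hardySobolevExponent n s - 1) * u x ^ (hardySobolevExponent n s - 1 - 1) *
        (‖Q.starProjection x‖ ^ s)⁻¹ :=
      mul_nonneg (mul_nonneg (by linarith)
        (Real.rpow_nonneg (hpos x (mem_negHalfSpace.2 hx)).le _))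
        (inv_nonneg.2 (Real.rpow_nonneg (norm_nonneg _) s))
    have h5 : 1 ≤ (1 - ⟪firstVec n, x⟫) ^ 2 := one_le_pow₀ (by linarith)
    have h6 := mul_le_mul_of_nonneg_left h5 h4
    linarith
  · obtain ⟨K, hK, h⟩ := hpot l hl
    obtain ⟨R, hR⟩ := exists_forall_rpow_neg_le (a := 2 - s) (K := K) (by linarith) hε
    exact ⟨R, fun x hx hlx hxR => (h x hx hlx).trans (hR _ hxR)⟩

/-! ### Symmetry of the solution. -/

theorem proposition1p1 (n : ℕ) [NeZero n] (hn : 3 ≤ n)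
    (Q : Submodule ℝ (EuclideanSpace ℝ (Fin n)))
    (hQdim : 2 ≤ Module.finrank ℝ Q)
    (hQ : (Qᗮ : Set (EuclideanSpace ℝ (Fin n))) ⊆ frontier (negHalfSpace n))
    (s : ℝ) (hs0 : 0 < s) (hs2 : s < 2)
    (u : EuclideanSpace ℝ (Fin n) → ℝ)
    (hu2 : ContDiffOn ℝ 2 u (negHalfSpace n))
    (hu1 : ContDiffOn ℝ 1 u (closure (negHalfSpace n)))
    (heq : ∀ x ∈ negHalfSpace n,
      -(Laplacian.laplacian u x) =
        u x ^ (hardySobolevExponent n s - 1) / ‖Q.starProjection x‖ ^ s)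
    (hpos : ∀ x ∈ negHalfSpace n, 0 < u x)
    (hbdry : ∀ x ∈ frontier (negHalfSpace n), u x = 0)
    (C : ℝ) (hC : 0 < C)
    (hbound : ∀ x ∈ negHalfSpace n, u x ≤ C * (1 + ‖x‖) ^ (1 - (n : ℝ))) :
    ∃ v : ℝ × ℝ × Qᗮ → ℝ,
      ContDiffOn ℝ 2 v (Set.Iio 0 ×ˢ (Set.univ ×ˢ Set.univ)) ∧
      ContDiffOn ℝ 1 v (Set.Iic 0 ×ˢ (Set.univ ×ˢ Set.univ)) ∧
      ∀ (z : Qᗮ) (x₁ : ℝ) (y : EuclideanSpace ℝ (Fin n)),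
        x₁ < 0 → y 0 = 0 → x₁ • firstVec n + y ∈ Q →
          u (x₁ • firstVec n + y + (z : EuclideanSpace ℝ (Fin n))) = v (x₁, ‖y‖, z) := by
  have hze : ∀ z ∈ Qᗮ, ⟪firstVec n, z⟫ = 0 := fun z hz => mem_frontier_negHalfSpace.1 (hQ hz)
  have he : firstVec n ∈ Q := by
    rw [← Q.orthogonal_orthogonal, Submodule.mem_orthogonal']
    exact hze
  obtain ⟨ν₀, hν₀Q, hν₀, hν₀e⟩ := exists_unit_mem_orthogonal hQdim he norm_firstVec
  have hsol : ∀ ν ∈ Q, ‖ν‖ = 1 → ⟪firstVec n, ν⟫ = 0 → _ := fun ν h1 h2 h3 =>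
    isMovingPlaneSolution_of_decay hn he hs0 hs2 hu2 hu1.continuousOn heq hpos hbdry hC hbound
      (ν := ν) h1 h2 h3
  -- The function `v` is `u` read on the slice through one fixed direction `ν₀`, hence inherits its
  -- regularity up to the boundary.
  set Φ : ℝ × ℝ × Qᗮ → EuclideanSpace ℝ (Fin n) :=
    fun q => q.1 • firstVec n + q.2.1 • ν₀ + (q.2.2 : EuclideanSpace ℝ (Fin n)) with hΦ
  have hΦe : ∀ q, ⟪firstVec n, Φ q⟫ = q.1 := fun q => by
    simp only [hΦ, inner_add_right, real_inner_smul_right, hν₀e, hze _ q.2.2.2,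
      real_inner_self_eq_norm_sq, norm_firstVec]
    ring
  have hΦs : ∀ m, ContDiff ℝ m Φ := fun m => by
    have : ContDiff ℝ m fun q : ℝ × ℝ × Qᗮ => (q.2.2 : EuclideanSpace ℝ (Fin n)) :=
      Qᗮ.subtypeL.contDiff.comp (by fun_prop)
    simp only [hΦ]
    fun_prop
  refine ⟨u ∘ Φ, hu2.comp (hΦs 2).contDiffOn fun q hq => ?_,
    hu1.comp (hΦs 1).contDiffOn fun q hq => ?_, fun z x₁ y hx₁ hy hyQ => ?_⟩
  · rw [mem_negHalfSpace, hΦe]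
    exact hq.1
  · rw [mem_closure_negHalfSpace, hΦe]
    exact hq.1
  · have hyQ' : y ∈ Q := (Q.add_mem_iff_right (Q.smul_mem x₁ he)).1 hyQ
    have hye : ⟪firstVec n, y⟫ = 0 := (inner_firstVec y).trans hy
    -- Reflection along `d` takes `y` to `‖y‖ • ν₀` and fixes `firstVec n` and `Qᗮ`.
    set d := y - ‖y‖ • ν₀ with hd
    have hdQ : d ∈ Q := Q.sub_mem hyQ' (Q.smul_mem _ hν₀Q)
    have hde : ⟪firstVec n, d⟫ = 0 := by
      rw [hd, inner_sub_right, real_inner_smul_right, hye, hν₀e, mul_zero, sub_zero]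
    have htarget : Φ (x₁, ‖y‖, z) = x₁ • firstVec n + y + z - d := by
      simp only [hΦ, hd]
      abel
    rw [Function.comp_apply, htarget]
    by_cases hd0 : d = 0
    · rw [hd0, sub_zero]
    have hinner : 2 * ⟪d, x₁ • firstVec n + y + z⟫ = ‖d‖ ^ 2 := by
      have hdz : ⟪d, (z : EuclideanSpace ℝ (Fin n))⟫ = 0 := (Q.mem_orthogonal _).1 z.2 d hdQ
      rw [inner_add_right, inner_add_right, real_inner_smul_right, hdz, real_inner_comm, hde, hd,
        norm_sub_sq_real, norm_smul, inner_sub_left, real_inner_smul_left, real_inner_smul_right,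
        hν₀, real_inner_comm y ν₀, real_inner_self_eq_norm_sq, norm_norm]
      ring
    rw [← planeReflection_normalize hd0 hinner]
    have hνQ : ‖d‖⁻¹ • d ∈ Q := Q.smul_mem _ hdQ
    have hν1 : ‖‖d‖⁻¹ • d‖ = 1 := norm_smul_inv_norm hd0
    have hνe : ⟪firstVec n, ‖d‖⁻¹ • d⟫ = 0 := by rw [real_inner_smul_right, hde, mul_zero]
    refine ((hsol _ hνQ hν1 hνe).reflection_zero_eq (hsol _ (Q.neg_mem hνQ) ?_ ?_) ?_).symm
    · rw [norm_neg, hν1]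
    · rw [inner_neg_right, hνe, neg_zero]
    · rw [inner_add_right, inner_add_right, real_inner_smul_right, hze _ z.2, hye,
        real_inner_self_eq_norm_sq, norm_firstVec]
      linarith
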